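/- Let $q$ be a prime power, $m\ge 2$ an integer, $d=(q^{m+1}-1)/(q-1)$ and $k=(q^m-1)/(q-1)$. Let $\mathcal X=(X,\{R_i\}_{i=0}^d)$ be a (commutative) association scheme of class $d$ with first eigenmatrix $$P=\begin{bmatrix}1&f\mathbf 1_d^T\\ \mathbf 1_d& rM+s(J-M)\end{bmatrix},$$ where $M$ is a hyperplane–point incidence matrix of the projective space $\mathrm{PG}(m,q)$ (rows labelled by hyperplanes, columns by points), $J$ is an all-ones matrix and $\mathbf 1_n$ is the all-ones column vector of length $n$. Here a fusion scheme of $\mathcal X$ is an association scheme $(X,\{\bigcup_{l\in\Lambda_j}R_l\}_{j=0}^{d'})$ for some partition $\{\Lambda_j\}_{j=0}^{d'}$ of $\{0,\dots,d\}$ with $\Lambda_0=\{0\}$, and a scheme is amorphous if every such partition of its relations gives an association scheme. First eigenmatrices are taken with respect to some ordering of the primitive idempotents with $|X|^{-1}J$ first. (i) $\mathcal X$ has a fusion scheme of class $q+2$ with the first eigenmatrix $$\begin{bmatrix}1&(d-q-1)f&f\mathbf 1_{q+1}^T\\ 1&(k-q-1)r+(d-k)s&r\mathbf 1_{q+1}^T\\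 \mathbf 1_{q+1}&((k-1)r+(d-k-q)s)\mathbf 1_{q+1}&(r-s)I+sJ\end{bmatrix}.$$ More precisely, for every line $L$ of $\mathrm{PG}(m,q)$ and every ordering of its points, such a fusion scheme is obtained by fusing all relations $R_j$ whose columns of $M$ correspond to points off $L$ and keeping apart the $q+1$ relations that correspond to the points of $L$. (ii) If $m=3$, then $\mathcal X$ has an amorphous fusion scheme of class $q^2+1$ with the first eigenmatrix $$\begin{bmatrix}1&(q+1)f\mathbf 1_{q^2+1}^T\\ \mathbf 1_{q^2+1}&q(r-s)I+(r+sq)J\end{bmatrix}.$$ More precisely, for every spread of $\mathrm{PG}(3,q)$ (a set of lines which partition the points) and every ordering of its $q^2+1$ lines, such a fusion scheme is obtained by fusing, for each line of the spread, the $q+1$ relations that correspond to its points. -/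

import Mathlib

open scoped LinearAlgebra.Projectivization

noncomputable section

namespace AssocScheme

section Schemes

variable {X : Type*} [Fintype X] {d : ℕ}

open Classical in
/-- The relations `R 0, …, R d` on the finite set `X` form a (commutative) association scheme of
class `d`. Symmetric association schemes are those in which every `R i` is symmetric. -/
structure IsAssociationScheme (R : Fin (d + 1) → X → X → Prop) : Prop where
  nonempty : ∀ i, ∃ x y, R i x y
  diagonal : ∀ x y, R 0 x y ↔ x = y
  partition : ∀ x y, ∃! i, R i x y
  transpose : ∀ i, ∃ i', ∀ x y, R i' x y ↔ R i y x
  /-- existence of the intersection numbers -/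
  intersection : ∀ i j k, ∃ p : ℕ, ∀ x y, R k x y →
    (Finset.univ.filter fun z => R i x z ∧ R j z y).card = p
  commutative : ∀ i j x y, (Finset.univ.filter fun z => R i x z ∧ R j z y).card =
    (Finset.univ.filter fun z => R j x z ∧ R i z y).card

open Classical in
/-- The adjacency matrix of a relation. -/
def adjacencyMatrix (r : X → X → Prop) : Matrix X X ℂ :=
  Matrix.of fun x y => if r x y then 1 else 0

/-- The Bose–Mesner algebra (as a space of matrices): the span of the adjacency matrices. -/
def boseMesner (R : Fin (d + 1) → X → X → Prop) : Submodule ℂ (Matrix X X ℂ) :=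
  Submodule.span ℂ (Set.range fun i => adjacencyMatrix (R i))

/-- `E 0, …, E d` are the primitive idempotents of the Bose–Mesner algebra, with `E 0 = |X|⁻¹ J`:
since the algebra has dimension `d + 1`, a complete system of `d + 1` nonzero pairwise orthogonal
idempotents in it consists precisely of its primitive idempotents. -/
structure IsPrimitiveIdempotents [DecidableEq X] (R : Fin (d + 1) → X → X → Prop)
    (E : Fin (d + 1) → Matrix X X ℂ) : Prop where
  complete : CompleteOrthogonalIdempotents E
  ne_zero : ∀ i, E i ≠ 0
  mem : ∀ i, E i ∈ boseMesner R
  zero : E 0 = (Fintype.card X : ℂ)⁻¹ • Matrix.of fun _ _ => 1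

/-- `P` is the first eigenmatrix of the scheme `R`, for some ordering of the nontrivial primitive
idempotents: `A j = ∑ i, P i j • E i`. -/
def HasFirstEigenmatrix [DecidableEq X] (R : Fin (d + 1) → X → X → Prop)
    (P : Matrix (Fin (d + 1)) (Fin (d + 1)) ℂ) : Prop :=
  ∃ E : Fin (d + 1) → Matrix X X ℂ, IsPrimitiveIdempotents R E ∧
    ∀ j, adjacencyMatrix (R j) = ∑ i, P i j • E i

/-- `g` describes a partition of `{0, …, d}` into (nonempty) parts `Λ j = g ⁻¹' {j}`,
`0 ≤ j ≤ d'`, with `Λ 0 = {0}`. -/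
def IsFusionMap {d d' : ℕ} (g : Fin (d + 1) → Fin (d' + 1)) : Prop :=
  Function.Surjective g ∧ ∀ l, g l = 0 ↔ l = 0

/-- The relations obtained by uniting the relations in each part of the partition `g`. -/
def fuse {X : Type*} {d d' : ℕ} (R : Fin (d + 1) → X → X → Prop)
    (g : Fin (d + 1) → Fin (d' + 1)) : Fin (d' + 1) → X → X → Prop :=
  fun j x y => ∃ l, g l = j ∧ R l x y

/-- `R'` is a fusion scheme of `R`. -/
def IsFusionScheme {d' : ℕ} (R : Fin (d + 1) → X → X → Prop)
    (R' : Fin (d' + 1) → X → X → Prop) : Prop :=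
  IsAssociationScheme R' ∧ ∃ g : Fin (d + 1) → Fin (d' + 1), IsFusionMap g ∧ R' = fuse R g

/-- A scheme is amorphous if every partition of its relations (keeping the diagonal apart)
gives an association scheme. -/
def IsAmorphous (R : Fin (d + 1) → X → X → Prop) : Prop :=
  IsAssociationScheme R ∧ ∀ (e : ℕ) (g : Fin (d + 1) → Fin (e + 1)), IsFusionMap g →
    IsAssociationScheme (fuse R g)

end Schemes

/-- The all-ones matrix `J`. -/
def allOnes (n : ℕ) : Matrix (Fin n) (Fin n) ℂ := Matrix.of fun _ _ => 1

/-- The matrix with first row `(1, v)`, first column `(1, …, 1)` and principal part `P₀`. -/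
def bordered {n : ℕ} (v : Fin n → ℂ) (P₀ : Matrix (Fin n) (Fin n) ℂ) :
    Matrix (Fin (n + 1)) (Fin (n + 1)) ℂ :=
  Matrix.of (Matrix.vecCons (Matrix.vecCons 1 v) fun i => Matrix.vecCons 1 (P₀ i))

section Geometry

variable (F : Type*) [Field F]

/-- The points of `PG(m, F)`. -/
abbrev Point (m : ℕ) : Type _ := ℙ F (Fin (m + 1) → F)

/-- The hyperplanes of `PG(m, F)`. -/
abbrev Hyperplane (m : ℕ) : Type _ :=
  {H : Submodule F (Fin (m + 1) → F) // Module.finrank F H = m}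

/-- The lines of `PG(m, F)`. -/
abbrev Line (m : ℕ) : Type _ :=
  {L : Submodule F (Fin (m + 1) → F) // Module.finrank F L = 2}

variable {F}

/-- The point `p` lies on the projective subspace given by `W`. -/
def LiesOn {m : ℕ} (p : Point F m) (W : Submodule F (Fin (m + 1) → F)) : Prop :=
  p.submodule ≤ W

/-- A spread (of lines): a set of lines which partition the set of points. -/
def IsSpread {m : ℕ} (S : Set (Line F m)) : Prop :=
  ∀ p : Point F m, ∃! L : Line F m, L ∈ S ∧ LiesOn p L.1

open Classical in
/-- The hyperplane–point incidence matrix of `PG(m, F)`, with rows and columns labelled through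
the given bijections. -/
def incidenceMatrix {m d : ℕ} (hyp : Fin d ≃ Hyperplane F m) (pt : Fin d ≃ Point F m) :
    Matrix (Fin d) (Fin d) ℂ :=
  Matrix.of fun i j => if LiesOn (pt j) (hyp i).1 then 1 else 0

end Geometry

/-- The matrix with first row `(1, (d-q-1) f, f, …, f)`, second row
`(1, (k-q-1) r + (d-k) s, r, …, r)`, and `q + 1` further rows
`(1, (k-1) r + (d-k-q) s, row of (r-s) I + s J)`. -/
def lineFusionMatrix (d k q : ℕ) (f r s : ℂ) : Matrix (Fin (q + 2 + 1)) (Fin (q + 2 + 1)) ℂ :=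
  bordered (Matrix.vecCons (((d : ℂ) - q - 1) * f) fun _ : Fin (q + 1) => f)
    (Matrix.of (Matrix.vecCons
      (Matrix.vecCons (((k : ℂ) - q - 1) * r + ((d : ℂ) - k) * s) fun _ : Fin (q + 1) => r)
      fun i : Fin (q + 1) => Matrix.vecCons (((k : ℂ) - 1) * r + ((d : ℂ) - k - q) * s)
        (((r - s) • (1 : Matrix (Fin (q + 1)) (Fin (q + 1)) ℂ) + s • allOnes (q + 1)) i)))

/-- The matrix with first row `(1, (q+1) f, …, (q+1) f)` and principal part
`q (r-s) I + (r + s q) J`. -/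
def spreadFusionMatrix (q : ℕ) (f r s : ℂ) :
    Matrix (Fin (q ^ 2 + 1 + 1)) (Fin (q ^ 2 + 1 + 1)) ℂ :=
  bordered (fun _ => ((q : ℂ) + 1) * f)
    (((q : ℂ) * (r - s)) • 1 + (r + s * q) • allOnes (q ^ 2 + 1))

end AssocScheme

end

noncomputable section

namespace AssocScheme

/-! ### Fusion of association schemes and the Bannai–Muzychuk criterion. -/

section Fusion

variable {X : Type*} {d : ℕ}

/-! Everything rests on the Bannai–Muzychuk criterion `fuse_of_block_row_sums`: partition the
columns and the rows of the eigenmatrix into equally many classes so that block row sums are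
constant. Each fused adjacency matrix is then a combination of the merged idempotents, and equality
of dimensions makes the two spans coincide; the span is thus a commutative algebra closed under
conjugate transposition, which yields a scheme.

The rows are classes of hyperplanes. For a line `L`, a hyperplane either contains `L` or meets it in
one point; containing `L` is one class, and each intersection point gives another. For a spread of
PG(3,q), a plane contains exactly one spread line: if it contains n of them, counting its points
gives (q² + 1) + nq = q² + q + 1. Planes are classed by that line. In both cases `sum_line_mul`
evaluates the block sums over the points of a line.

Amorphousness follows from the same criterion: when the principal part is aI + bJ and the first row
is constant after its initial 1, any partition of the columns also serves for the rows. -/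

theorem adjacencyMatrix_apply_of_rel {r : X → X → Prop} {x y : X} (h : r x y) :
    adjacencyMatrix r x y = 1 := by
  simp [adjacencyMatrix, h]

theorem adjacencyMatrix_apply_of_not_rel {r : X → X → Prop} {x y : X} (h : ¬ r x y) :
    adjacencyMatrix r x y = 0 := by
  simp [adjacencyMatrix, h]

theorem sum_smul_adjacencyMatrix_apply {R : Fin (d + 1) → X → X → Prop}
    (hpart : ∀ x y, ∃! i, R i x y) (c : Fin (d + 1) → ℂ) {k : Fin (d + 1)} {x y : X}
    (h : R k x y) : (∑ i, c i • adjacencyMatrix (R i)) x y = c k := by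
  rw [Matrix.sum_apply, Finset.sum_eq_single k]
  · simp [adjacencyMatrix_apply_of_rel h]
  · intro i _ hi
    have : ¬ R i x y := fun h' => hi ((hpart x y).unique h' h)
    simp [adjacencyMatrix_apply_of_not_rel this]
  · simp

theorem linearIndependent_adjacencyMatrix {R : Fin (d + 1) → X → X → Prop}
    (hne : ∀ i, ∃ x y, R i x y) (hpart : ∀ x y, ∃! i, R i x y) :
    LinearIndependent ℂ fun i => adjacencyMatrix (R i) := by
  rw [Fintype.linearIndependent_iff]
  intro c hc k
  obtain ⟨x, y, h⟩ := hne k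
  rw [← sum_smul_adjacencyMatrix_apply hpart c h, hc]
  rfl

/-- Elements of the Bose–Mesner algebra are constant on the relations. -/
theorem exists_apply_eq_of_mem_boseMesner {R : Fin (d + 1) → X → X → Prop}
    (hpart : ∀ x y, ∃! i, R i x y) {A : Matrix X X ℂ} (hA : A ∈ boseMesner R) :
    ∃ c : Fin (d + 1) → ℂ, ∀ k x y, R k x y → A x y = c k := by
  obtain ⟨c, rfl⟩ := (Submodule.mem_span_range_iff_exists_fun ℂ).1 hA
  exact ⟨c, fun k x y h => sum_smul_adjacencyMatrix_apply hpart c h⟩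

open Classical in
theorem adjacencyMatrix_mul_apply [Fintype X] (r r' : X → X → Prop) (x y : X) :
    (adjacencyMatrix r * adjacencyMatrix r') x y =
      ((Finset.univ.filter fun z => r x z ∧ r' z y).card : ℂ) := by
  rw [Matrix.mul_apply, Finset.card_filter]
  push_cast
  refine Finset.sum_congr rfl fun z _ => ?_
  by_cases h : r x z <;> by_cases h' : r' z y <;> simp [adjacencyMatrix, h, h']

open Matrix in
theorem conjTranspose_adjacencyMatrix (r : X → X → Prop) :
    (adjacencyMatrix r)ᴴ = adjacencyMatrix fun x y => r y x := by
  ext x y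
  by_cases h : r y x <;> simp [adjacencyMatrix, h]

open Matrix in
theorem conjTranspose_mem_boseMesner [Fintype X] {R : Fin (d + 1) → X → X → Prop}
    (hR : IsAssociationScheme R) {A : Matrix X X ℂ} (hA : A ∈ boseMesner R) :
    Aᴴ ∈ boseMesner R := by
  induction hA using Submodule.span_induction with
  | mem A h =>
    obtain ⟨i, rfl⟩ := h
    obtain ⟨i', hi'⟩ := hR.transpose i
    have : (adjacencyMatrix (R i))ᴴ = adjacencyMatrix (R i') := by
      rw [conjTranspose_adjacencyMatrix]
      congr 1
      ext x y
      exact (hi' x y).symm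
    simp only [this]
    exact Submodule.subset_span ⟨i', rfl⟩
  | zero => simp
  | add A B _ _ hA hB => simpa using Submodule.add_mem _ hA hB
  | smul c A _ hA => simpa using Submodule.smul_mem _ _ hA

theorem boseMesner_le_span {R : Fin (d + 1) → X → X → Prop} {E : Fin (d + 1) → Matrix X X ℂ}
    {P : Matrix (Fin (d + 1)) (Fin (d + 1)) ℂ}
    (hA : ∀ j, adjacencyMatrix (R j) = ∑ i, P i j • E i) :
    boseMesner R ≤ Submodule.span ℂ (Set.range E) := by
  refine Submodule.span_le.2 ?_
  rintro _ ⟨j, rfl⟩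
  simp only [hA j]
  exact Submodule.sum_mem _ fun i _ => Submodule.smul_mem _ _ (Submodule.subset_span ⟨i, rfl⟩)

/-- A dimension count: d + 1 independent adjacency matrices lie in the span of d + 1 elements, so
that span can be no larger. -/
theorem boseMesner_eq_span [Finite X] {R : Fin (d + 1) → X → X → Prop} {E : Fin (d + 1) → Matrix X X ℂ}
    {P : Matrix (Fin (d + 1)) (Fin (d + 1)) ℂ}
    (hne : ∀ i, ∃ x y, R i x y) (hpart : ∀ x y, ∃! i, R i x y)
    (hA : ∀ j, adjacencyMatrix (R j) = ∑ i, P i j • E i) :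
    boseMesner R = Submodule.span ℂ (Set.range E) := by
  refine Submodule.eq_of_le_of_finrank_le (boseMesner_le_span hA) ?_
  rw [boseMesner, finrank_span_eq_card (linearIndependent_adjacencyMatrix hne hpart)]
  exact finrank_range_le_card E

open scoped ComplexOrder in
/-- Primitive idempotents are Hermitian. -/
theorem conjTranspose_primitiveIdempotent [Fintype X] [DecidableEq X]
    {R : Fin (d + 1) → X → X → Prop}
    (hR : IsAssociationScheme R) {E : Fin (d + 1) → Matrix X X ℂ}
    (hE : IsPrimitiveIdempotents R E) {P : Matrix (Fin (d + 1)) (Fin (d + 1)) ℂ}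
    (hA : ∀ j, adjacencyMatrix (R j) = ∑ i, P i j • E i) (i : Fin (d + 1)) :
    (E i).conjTranspose = E i := by
  have hmem := boseMesner_le_span hA (conjTranspose_mem_boseMesner hR (hE.mem i))
  obtain ⟨c, hc⟩ := (Submodule.mem_span_range_iff_exists_fun ℂ).1 hmem
  have key : ∀ j, (E i).conjTranspose * E j = c j • E j := by
    intro j
    rw [← hc, Finset.sum_mul, Finset.sum_eq_single j]
    · rw [smul_mul_assoc, hE.complete.idem j]
    · intro l _ hl
      rw [smul_mul_assoc, hE.complete.ortho hl, smul_zero]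
    · simp
  -- If E_i* is a multiple of E_i, idempotency of E_i* forces the scalar to be 1.
  suffices h : (E i).conjTranspose = c i • E i by
    have hidem : (E i).conjTranspose * (E i).conjTranspose = (E i).conjTranspose := by
      rw [← Matrix.conjTranspose_mul, hE.complete.idem i]
    have hc1 : (c i - 1) • (E i).conjTranspose = 0 := by
      rw [sub_smul, one_smul, sub_eq_zero]
      conv_rhs => rw [← hidem]
      rw [h, smul_mul_smul_comm, hE.complete.idem i, smul_smul]
    rcases smul_eq_zero.1 hc1 with h1 | h1
    · rw [h, sub_eq_zero.1 h1, one_smul]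
    · exact absurd (Matrix.conjTranspose_eq_zero.1 h1) (hE.ne_zero i)
  rw [← hc, Finset.sum_eq_single i _ (by simp)]
  intro j _ hj
  -- For j ≠ i, c_j E_j*E_j = E_j*E_i*E_j = (E_iE_j)*E_j = 0, while E_j*E_j ≠ 0 by positivity.
  have h0 : (E j).conjTranspose * (E i).conjTranspose = 0 := by
    rw [← Matrix.conjTranspose_mul, hE.complete.ortho hj.symm, Matrix.conjTranspose_zero]
  have h1 : c j • ((E j).conjTranspose * E j) = 0 := by
    rw [← mul_smul_comm, ← key, ← mul_assoc, h0, zero_mul]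
  rcases smul_eq_zero.1 h1 with h | h
  · rw [h, zero_smul]
  · exact absurd (Matrix.conjTranspose_mul_self_eq_zero.1 h) (hE.ne_zero j)

/-- A partition of `X × X` whose adjacency matrices are combinations of equally many orthogonal
idempotents, whose span is closed
under conjugate transposition, is an association scheme. -/
theorem isAssociationScheme_of_orthogonalIdempotents [Fintype X] [DecidableEq X]
    {R : Fin (d + 1) → X → X → Prop}
    {E : Fin (d + 1) → Matrix X X ℂ} {P : Matrix (Fin (d + 1)) (Fin (d + 1)) ℂ}
    (hne : ∀ i, ∃ x y, R i x y) (hdiag : ∀ x y, R 0 x y ↔ x = y)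
    (hpart : ∀ x y, ∃! i, R i x y) (hE : CompleteOrthogonalIdempotents E)
    (hH : ∀ i, (E i).conjTranspose ∈ Submodule.span ℂ (Set.range E))
    (hA : ∀ j, adjacencyMatrix (R j) = ∑ i, P i j • E i) : IsAssociationScheme R := by
  classical
  have hspan := boseMesner_eq_span hne hpart hA
  have hmul : ∀ i j, adjacencyMatrix (R i) * adjacencyMatrix (R j) =
      ∑ t, (P t i * P t j) • E t := by
    intro i j
    rw [hA i, hA j, Finset.sum_mul]
    refine Finset.sum_congr rfl fun t _ => ?_
    rw [Finset.mul_sum, Finset.sum_eq_single t]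
    · rw [smul_mul_smul_comm, hE.idem t]
    · intro u _ hu
      rw [smul_mul_smul_comm, hE.ortho hu.symm, smul_zero]
    · simp
  refine ⟨hne, hdiag, hpart, ?_, ?_, ?_⟩
  · have hT : ∀ i, ∃ c : Fin (d + 1) → ℂ, ∀ k x y, R k x y →
        adjacencyMatrix (R i) y x = c k := by
      intro i
      have hmem : (adjacencyMatrix (R i)).conjTranspose ∈ boseMesner R := by
        rw [hspan, hA i, Matrix.conjTranspose_sum]
        refine Submodule.sum_mem _ fun t _ => ?_
        rw [Matrix.conjTranspose_smul]
        exact Submodule.smul_mem _ _ (hH t)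
      obtain ⟨c, hc⟩ := exists_apply_eq_of_mem_boseMesner hpart hmem
      refine ⟨c, fun k x y h => ?_⟩
      rw [← hc k x y h, conjTranspose_adjacencyMatrix]
      rfl
    have hT' : ∀ i k x y, R k x y → R i y x → ∀ x' y', R k x' y' → R i y' x' := by
      intro i k x y hk hi x' y' hk'
      obtain ⟨c, hc⟩ := hT i
      by_contra hcon
      have h1 := hc k x y hk
      have h2 := hc k x' y' hk'
      rw [adjacencyMatrix_apply_of_rel hi] at h1
      rw [adjacencyMatrix_apply_of_not_rel hcon, ← h1] at h2
      exact zero_ne_one h2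
    intro i
    obtain ⟨x, y, hi⟩ := hne i
    obtain ⟨i', hi', -⟩ := hpart y x
    exact ⟨i', fun a b => ⟨fun h => hT' i i' y x hi' hi a b h,
      fun h => hT' i' i x y hi hi' b a h⟩⟩
  · intro i j k
    have hmem : adjacencyMatrix (R i) * adjacencyMatrix (R j) ∈ boseMesner R := by
      rw [hspan, hmul]
      exact Submodule.sum_mem _ fun t _ =>
        Submodule.smul_mem _ _ (Submodule.subset_span ⟨t, rfl⟩)
    obtain ⟨c, hc⟩ := exists_apply_eq_of_mem_boseMesner hpart hmem
    obtain ⟨x₀, y₀, h₀⟩ := hne k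
    refine ⟨(Finset.univ.filter fun z => R i x₀ z ∧ R j z y₀).card, fun x y h => ?_⟩
    have := (hc k x y h).trans (hc k x₀ y₀ h₀).symm
    rw [adjacencyMatrix_mul_apply, adjacencyMatrix_mul_apply] at this
    convert Nat.cast_injective this
  · intro i j x y
    have : adjacencyMatrix (R i) * adjacencyMatrix (R j) =
        adjacencyMatrix (R j) * adjacencyMatrix (R i) := by
      rw [hmul, hmul]
      exact Finset.sum_congr rfl fun t _ => by rw [mul_comm]
    have := congrFun (congrFun this x) y
    rw [adjacencyMatrix_mul_apply, adjacencyMatrix_mul_apply] at this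
    convert Nat.cast_injective this

theorem adjacencyMatrix_fuse {d' : ℕ} {R : Fin (d + 1) → X → X → Prop}
    (hpart : ∀ x y, ∃! i, R i x y) (g : Fin (d + 1) → Fin (d' + 1)) (j : Fin (d' + 1)) :
    adjacencyMatrix (fuse R g j) = ∑ l with g l = j, adjacencyMatrix (R l) := by
  ext x y
  obtain ⟨k, hk, huniq⟩ := hpart x y
  have hz : ∀ l, l ≠ k → adjacencyMatrix (R l) x y = 0 := fun l hl =>
    adjacencyMatrix_apply_of_not_rel fun h => hl (huniq l h)
  rw [Matrix.sum_apply, Finset.sum_filter, Finset.sum_eq_single k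
    (fun l _ hl => by simp [hz l hl]) (by simp)]
  by_cases h : g k = j
  · rw [if_pos h, adjacencyMatrix_apply_of_rel hk, adjacencyMatrix_apply_of_rel]
    exact ⟨k, h, hk⟩
  · rw [if_neg h, adjacencyMatrix_apply_of_not_rel]
    rintro ⟨l, hl, hl'⟩
    exact h (huniq l hl' ▸ hl)

theorem completeOrthogonalIdempotents_sum_fiber {A : Type*} [Ring A] {ι κ : Type*} [Fintype ι]
    [Fintype κ] [DecidableEq κ] {E : ι → A} (hE : CompleteOrthogonalIdempotents E) (h : ι → κ) :
    CompleteOrthogonalIdempotents fun t => ∑ i with h i = t, E i := by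
  classical
  have hmul : ∀ i u, E i * (∑ i' with h i' = u, E i') = if h i = u then E i else 0 := by
    intro i u
    rw [Finset.mul_sum, Finset.sum_filter, Finset.sum_eq_single i]
    · rw [hE.idem i]
    · intro j _ hj
      rw [hE.ortho hj.symm, ite_self]
    · simp
  refine ⟨⟨fun t => ?_, fun t u htu => ?_⟩, ?_⟩
  · change _ * _ = _
    rw [Finset.sum_mul]
    refine Finset.sum_congr rfl fun i hi => ?_
    rw [hmul, if_pos (Finset.mem_filter.1 hi).2]
  · change _ * _ = _
    rw [Finset.sum_mul]
    refine Finset.sum_eq_zero fun i hi => ?_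
    rw [hmul, if_neg]
    rwa [(Finset.mem_filter.1 hi).2]
  · rw [Finset.sum_fiberwise, hE.complete]

/-- The Bannai–Muzychuk criterion: if the rows and the columns of the first eigenmatrix can be
partitioned into equally many parts such that the block row sums are constant, then fusing the
relations along the partition of the columns gives a scheme. -/
theorem fuse_of_block_row_sums [Fintype X] [DecidableEq X] {d' : ℕ}
    {R : Fin (d + 1) → X → X → Prop}
    (hR : IsAssociationScheme R) {P : Matrix (Fin (d + 1)) (Fin (d + 1)) ℂ}
    (hP : HasFirstEigenmatrix R P) {g h : Fin (d + 1) → Fin (d' + 1)}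
    (hg : IsFusionMap g) (hh : IsFusionMap h)
    {P' : Matrix (Fin (d' + 1)) (Fin (d' + 1)) ℂ}
    (hsum : ∀ i j, ∑ l with g l = j, P i l = P' (h i) j) :
    IsAssociationScheme (fuse R g) ∧ HasFirstEigenmatrix (fuse R g) P' := by
  obtain ⟨E, hE, hA⟩ := hP
  let E' : Fin (d' + 1) → Matrix X X ℂ := fun t => ∑ i with h i = t, E i
  have hE' : CompleteOrthogonalIdempotents E' :=
    completeOrthogonalIdempotents_sum_fiber hE.complete h
  have hA' : ∀ j, adjacencyMatrix (fuse R g j) = ∑ t, P' t j • E' t := by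
    intro j
    rw [adjacencyMatrix_fuse hR.partition]
    simp only [hA, E', Finset.smul_sum]
    rw [Finset.sum_comm, ← Finset.sum_fiberwise Finset.univ h]
    refine Finset.sum_congr rfl fun t _ => Finset.sum_congr rfl fun i hi => ?_
    rw [← Finset.sum_smul, hsum, (Finset.mem_filter.1 hi).2]
  have hne : ∀ j, ∃ x y, fuse R g j x y := by
    intro j
    obtain ⟨l, hl⟩ := hg.1 j
    obtain ⟨x, y, hxy⟩ := hR.nonempty l
    exact ⟨x, y, l, hl, hxy⟩
  have hdiag : ∀ x y, fuse R g 0 x y ↔ x = y := by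
    intro x y
    rw [← hR.diagonal]
    exact ⟨fun ⟨l, hl, hxy⟩ => (hg.2 l).1 hl ▸ hxy, fun hxy => ⟨0, (hg.2 0).2 rfl, hxy⟩⟩
  have hpart : ∀ x y, ∃! j, fuse R g j x y := by
    intro x y
    obtain ⟨l, hl, huniq⟩ := hR.partition x y
    refine ⟨g l, ⟨l, rfl, hl⟩, ?_⟩
    rintro j ⟨l', rfl, hl'⟩
    rw [huniq l' hl']
  have hH : ∀ t, (E' t).conjTranspose ∈ Submodule.span ℂ (Set.range E') := by
    intro t
    have : (E' t).conjTranspose = E' t := by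
      simp only [E', Matrix.conjTranspose_sum, conjTranspose_primitiveIdempotent hR hE hA]
    rw [this]
    exact Submodule.subset_span ⟨t, rfl⟩
  refine ⟨isAssociationScheme_of_orthogonalIdempotents hne hdiag hpart hE' hH hA',
    E', ⟨hE', ?_, ?_, ?_⟩, hA'⟩
  · intro t ht
    obtain ⟨i, hi⟩ := hh.1 t
    apply hE.ne_zero i
    -- A merged idempotent is nonzero because multiplying it by any of its summands recovers that
    -- summand.
    have : E i * E' t = E i := by
      simp only [E', Finset.mul_sum]
      rw [Finset.sum_eq_single i]
      · exact hE.complete.idem i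
      · intro j _ hj
        exact hE.complete.ortho hj.symm
      · simp [hi]
    rw [← this, ht, mul_zero]
  · intro t
    rw [boseMesner_eq_span hne hpart hA']
    exact Submodule.subset_span ⟨t, rfl⟩
  · rw [← hE.zero]
    simp [E', hh.2, Finset.filter_eq']

end Fusion

theorem sum_filter_eq_add_sum_succ {M : Type*} [AddCommMonoid M] {κ : Type*} [DecidableEq κ]
    {d : ℕ} (g : Fin (d + 1) → κ) (a : Fin (d + 1) → M) (u : κ) :
    ∑ l with g l = u, a l =
      (if g 0 = u then a 0 else 0) + ∑ j : Fin d, if g j.succ = u then a j.succ else 0 := by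
  rw [Finset.sum_filter, Fin.sum_univ_succ]

/-- A scheme whose first eigenmatrix has a principal part in the span of `I` and `J` and a constant
first row is amorphous. -/
theorem isAmorphous_of_hasFirstEigenmatrix {X : Type*} [Fintype X] [DecidableEq X] {n : ℕ}
    {R : Fin (n + 1) → X → X → Prop} (hR : IsAssociationScheme R) {v a b : ℂ}
    (hP : HasFirstEigenmatrix R (bordered (fun _ => v) (a • 1 + b • allOnes n))) :
    IsAmorphous R := by
  refine ⟨hR, fun e g hg => ?_⟩
  set P := bordered (fun _ => v) (a • 1 + b • allOnes n) with hPdef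
  -- With the same partition on rows and columns, a nontrivial row i has sum a·[g i = u] + b·|class
  -- u| over a class u of nontrivial columns, which depends only on g i. Row 0 is alone in its
  -- class.
  have key : ∀ i i', g i = g i' → ∀ u, ∑ l with g l = u, P i l = ∑ l with g l = u, P i' l := by
    intro i i' hii u
    by_cases hi : i = 0
    · rw [hi, (hg.2 i').1 (hii ▸ (hg.2 i).2 hi)]
    have hi' : i' ≠ 0 := fun h => hi ((hg.2 i).1 (hii.trans ((hg.2 i').2 h)))
    have hrow : ∀ j : Fin n, ∑ l with g l = u, P j.succ l =
        (if g 0 = u then 1 else 0) +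
          ((if g j.succ = u then a else 0) + ∑ l : Fin n, if g l.succ = u then b else 0) := by
      intro j
      rw [sum_filter_eq_add_sum_succ]
      congr 1
      have : ∀ l : Fin n, (if g l.succ = u then P j.succ l.succ else 0) =
          (if j = l then (if g j.succ = u then a else 0) else 0) +
            if g l.succ = u then b else 0 := by
        intro l
        have hval : P j.succ l.succ = a * (1 : Matrix (Fin n) (Fin n) ℂ) j l + b * 1 := rfl
        rw [hval, Matrix.one_apply]
        by_cases hjl : j = l
        · subst hjl
          split_ifs <;> simp
        · simp [hjl]
      rw [Finset.sum_congr rfl fun l _ => this l, Finset.sum_add_distrib]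
      simp
    obtain ⟨j, rfl⟩ := Fin.exists_succ_eq_of_ne_zero hi
    obtain ⟨j', rfl⟩ := Fin.exists_succ_eq_of_ne_zero hi'
    rw [hrow, hrow, hii]
  exact (fuse_of_block_row_sums hR hP hg hg
    -- The fused eigenmatrix is read off from one representative row of each class.
    (P' := Matrix.of fun t u => ∑ l with g l = u, P (Function.surjInv hg.1 t) l)
    fun i u => key _ _ (Function.surjInv_eq hg.1 (g i)).symm u).1

/-! ### Incidence of points, lines and hyperplanes. -/

section Geometry

variable {F : Type*} [Field F] {m : ℕ}

theorem liesOn_mk {v : Fin (m + 1) → F} (hv : v ≠ 0) {W : Submodule F (Fin (m + 1) → F)} :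
    LiesOn (Projectivization.mk F v hv : Point F m) W ↔ v ∈ W := by
  rw [LiesOn, Projectivization.submodule_mk, Submodule.span_singleton_le_iff_mem]

theorem le_of_forall_liesOn {V W : Submodule F (Fin (m + 1) → F)}
    (h : ∀ p : Point F m, LiesOn p V → LiesOn p W) : V ≤ W := by
  intro v hv
  by_cases h0 : v = 0
  · rw [h0]
    exact W.zero_mem
  · exact (liesOn_mk h0).1 (h _ ((liesOn_mk h0).2 hv))

theorem natCard_liesOn [Finite F] {n : ℕ} {W : Submodule F (Fin (m + 1) → F)}
    (hW : Module.finrank F W = n) :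
    Nat.card {p : Point F m // LiesOn p W} = ∑ i ∈ Finset.range n, Nat.card F ^ i := by
  rw [← Projectivization.card_of_finrank F W hW]
  have hlies : ∀ p : ℙ F W,
      LiesOn (Projectivization.map W.subtype W.injective_subtype p) W := by
    intro p
    induction p using Projectivization.ind with
    | h v hv => exact (liesOn_mk _).2 v.2
  refine (Nat.card_congr (Equiv.ofBijective
    (fun p => ⟨Projectivization.map W.subtype W.injective_subtype p, hlies p⟩) ⟨?_, ?_⟩)).symm
  · intro p p' h
    exact Projectivization.map_injective _ W.injective_subtype (congrArg Subtype.val h)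
  · rintro ⟨p, hp⟩
    induction p using Projectivization.ind with
    | h v hv =>
      refine ⟨Projectivization.mk F ⟨v, (liesOn_mk hv).1 hp⟩ fun h =>
        hv (congrArg Subtype.val h), ?_⟩
      exact Subtype.ext (Projectivization.map_mk W.subtype W.injective_subtype _ _)

open Classical in
/-- The characteristic function of the set of points on `W`. -/
def pointIndicator (W : Submodule F (Fin (m + 1) → F)) (p : Point F m) : ℂ :=
  if LiesOn p W then 1 else 0

theorem pointIndicator_inf (V W : Submodule F (Fin (m + 1) → F)) (p : Point F m) :
    pointIndicator (V ⊓ W) p = pointIndicator V p * pointIndicator W p := by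
  have : LiesOn p (V ⊓ W) ↔ LiesOn p V ∧ LiesOn p W := le_inf_iff
  by_cases h : LiesOn p V <;> by_cases h' : LiesOn p W <;> simp [pointIndicator, this, h, h']

theorem sum_pointIndicator [Finite F] {ι : Type*} [Fintype ι] (pt : ι ≃ Point F m) {n : ℕ}
    {W : Submodule F (Fin (m + 1) → F)} (hW : Module.finrank F W = n) :
    ∑ j, pointIndicator W (pt j) = ∑ i ∈ Finset.range n, (Nat.card F : ℂ) ^ i := by
  classical
  have h := natCard_liesOn hW
  rw [Nat.card_congr (pt.subtypeEquivOfSubtype (p := fun p => LiesOn p W)).symm,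
    Nat.card_eq_fintype_card, Fintype.card_subtype] at h
  simp only [pointIndicator, Finset.sum_boole]
  exact_mod_cast h

theorem sum_pointIndicator_line [Finite F] {ι : Type*} [Fintype ι] (pt : ι ≃ Point F m)
    (L : Line F m) : ∑ j, pointIndicator L.1 (pt j) = (Nat.card F : ℂ) + 1 := by
  rw [sum_pointIndicator pt L.2]
  simp [Finset.sum_range_succ, add_comm]

/-- As W is not inside H, the sum W + H is the whole space, and the dimension formula applies. -/
theorem finrank_inf_hyperplane {W : Submodule F (Fin (m + 1) → F)} (H : Hyperplane F m)
    (h : ¬ W ≤ H.1) : Module.finrank F ↥(W ⊓ H.1) + 1 = Module.finrank F W := by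
  have hsum := Submodule.finrank_sup_add_finrank_inf_eq W H.1
  have hlt : Module.finrank F H.1 < Module.finrank F ↥(W ⊔ H.1) :=
    Submodule.finrank_lt_finrank_of_lt (right_lt_sup.2 h)
  have hle : Module.finrank F ↥(W ⊔ H.1) ≤ m + 1 := by
    simpa using Submodule.finrank_le (W ⊔ H.1)
  have hH := H.2
  omega

theorem exists_hyperplane_of_notMem {W : Submodule F (Fin (m + 1) → F)} {v : Fin (m + 1) → F}
    (hv : v ∉ W) : ∃ H : Hyperplane F m, W ≤ H.1 ∧ v ∉ H.1 := by
  obtain ⟨φ, hφ, hle⟩ := Submodule.exists_le_ker_of_notMem hv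
  have hne : φ ≠ 0 := fun h => hφ (by simp [h])
  have := Module.Dual.finrank_ker_add_one_of_ne_zero hne
  rw [Module.finrank_fin_fun] at this
  exact ⟨⟨LinearMap.ker φ, by omega⟩, hle, hφ⟩

theorem exists_hyperplane_of_line_le (hm : 1 < m) (L : Line F m) :
    ∃ H : Hyperplane F m, L.1 ≤ H.1 := by
  have hlt : L.1 < ⊤ := by
    rw [lt_top_iff_ne_top]
    intro h
    have := L.2
    rw [h, finrank_top, Module.finrank_fin_fun] at this
    omega
  obtain ⟨v, -, hv⟩ := SetLike.exists_of_lt hlt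
  obtain ⟨H, hH, -⟩ := exists_hyperplane_of_notMem hv
  exact ⟨H, hH⟩

theorem point_eq_of_liesOn {p p' : Point F m} (h : LiesOn p p'.submodule) : p = p' :=
  Projectivization.submodule_injective (Submodule.eq_of_le_of_finrank_eq h
    (by rw [Projectivization.finrank_submodule, Projectivization.finrank_submodule]))

/-- A point is a proper subspace of the line, so some functional vanishes on it but not on the line.
This makes every point of a line occur as an intersection point, so no row class is empty. -/
theorem exists_hyperplane_inter_line (L : Line F m) {p : Point F m} (hp : LiesOn p L.1) :
    ∃ H : Hyperplane F m, LiesOn p H.1 ∧ ¬ L.1 ≤ H.1 := by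
  have hlt : p.submodule < L.1 := by
    refine lt_of_le_of_ne hp fun h => ?_
    have := L.2
    rw [← h, Projectivization.finrank_submodule] at this
    omega
  obtain ⟨v, hvL, hv⟩ := SetLike.exists_of_lt hlt
  obtain ⟨H, hH, hvH⟩ := exists_hyperplane_of_notMem hv
  exact ⟨H, hH, fun h => hvH (h hvL)⟩

/-- A line which is not contained in a hyperplane meets it in exactly one point. -/
theorem exists_point_inter (L : Line F m) (H : Hyperplane F m) (h : ¬ L.1 ≤ H.1) :
    ∃ p : Point F m, LiesOn p L.1 ∧ ∀ p', LiesOn p' L.1 → (LiesOn p' H.1 ↔ p' = p) := by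
  have h1 : Module.finrank F ↥(L.1 ⊓ H.1) = 1 := by
    have := finrank_inf_hyperplane H h
    have := L.2
    omega
  have hsub := Projectivization.submodule_mk'' (L.1 ⊓ H.1) h1
  refine ⟨Projectivization.mk'' (L.1 ⊓ H.1) h1, ?_, fun p' hp' => ⟨fun hH => ?_, ?_⟩⟩
  · rw [LiesOn, hsub]
    exact inf_le_left
  · apply point_eq_of_liesOn
    rw [LiesOn, hsub]
    exact le_inf hp' hH
  · rintro rfl
    rw [LiesOn, hsub]
    exact inf_le_right

/-- The sum over the points of a line of an entry function of a hyperplane. -/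
theorem sum_line_mul [Finite F] {ι : Type*} [Fintype ι] (pt : ι ≃ Point F m) (L : Line F m)
    (H : Hyperplane F m) (r s : ℂ) [Decidable (L.1 ≤ H.1)] :
    ∑ j, pointIndicator L.1 (pt j) * (s + (r - s) * pointIndicator H.1 (pt j)) =
      s * (Nat.card F + 1) + (r - s) * if L.1 ≤ H.1 then (Nat.card F : ℂ) + 1 else 1 := by
  -- The product of the two indicators is that of L ⊓ H, which is either L or a single point.
  have h1 : ∑ j, pointIndicator (L.1 ⊓ H.1) (pt j) =
      if L.1 ≤ H.1 then (Nat.card F : ℂ) + 1 else 1 := by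
    split_ifs with h
    · rw [inf_eq_left.2 h, sum_pointIndicator_line]
    · have h1 : Module.finrank F ↥(L.1 ⊓ H.1) = 1 := by
        have := finrank_inf_hyperplane H h
        have := L.2
        omega
      rw [sum_pointIndicator pt h1]
      simp
  rw [← h1, ← sum_pointIndicator_line pt L, Finset.mul_sum, Finset.mul_sum,
    ← Finset.sum_add_distrib]
  refine Finset.sum_congr rfl fun j _ => ?_
  rw [pointIndicator_inf]
  ring

theorem eigenmatrix_apply {d : ℕ} (hyp : Fin d ≃ Hyperplane F m) (pt : Fin d ≃ Point F m)
    (f r s : ℂ) (i j : Fin d) :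
    bordered (fun _ => f) (r • incidenceMatrix hyp pt + s • (allOnes d - incidenceMatrix hyp pt))
      i.succ j.succ = s + (r - s) * pointIndicator (hyp i).1 (pt j) := by
  have : bordered (fun _ => f)
      (r • incidenceMatrix hyp pt + s • (allOnes d - incidenceMatrix hyp pt)) i.succ j.succ =
      r * pointIndicator (hyp i).1 (pt j) + s * (1 - pointIndicator (hyp i).1 (pt j)) := rfl
  rw [this]
  ring

end Geometry

/-- The shift by one reserves class 0 for index 0, for relations and idempotents alike. -/
theorem isFusionMap_cons {d n : ℕ} {a : Fin d → Fin n} (ha : Function.Surjective a) :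
    IsFusionMap (Fin.cons 0 fun j => (a j).succ : Fin (d + 1) → Fin (n + 1)) := by
  refine ⟨fun t => ?_, fun l => ?_⟩
  · cases t using Fin.cases with
    | zero => exact ⟨0, rfl⟩
    | succ t =>
      obtain ⟨j, rfl⟩ := ha t
      exact ⟨j.succ, rfl⟩
  · cases l using Fin.cases with
    | zero => simp
    | succ j => simp [Fin.succ_ne_zero]

/-! ### Part (i): fusing the points off a line. -/

section Line

variable {F : Type*} [Field F] {m : ℕ}

theorem natCast_eq_geom_sum {q n c : ℕ} (hq : 2 ≤ q) (hc : c = (q ^ n - 1) / (q - 1)) :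
    (c : ℂ) = ∑ i ∈ Finset.range n, (q : ℂ) ^ i := by
  rw [hc, ← Nat.geomSum_eq hq]
  push_cast
  rfl

theorem exists_line (hm : 1 < m) : Nonempty (Line F m) := by
  obtain ⟨v, hv⟩ := exists_linearIndependent_of_le_finrank (R := F) (M := Fin (m + 1) → F)
    (n := 2) (by rw [Module.finrank_fin_fun]; omega)
  exact ⟨⟨Submodule.span F (Set.range v), by rw [finrank_span_eq_card hv, Fintype.card_fin]⟩⟩

theorem natCard_liesOn_line [Finite F] (L : Line F m) :
    Nat.card {p : Point F m // LiesOn p L.1} = Nat.card F + 1 := by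
  rw [natCard_liesOn L.2]
  simp [Finset.sum_range_succ, add_comm]

/-- Fusing all relations that correspond to points off a line. -/
theorem exists_line_fusion [Fintype F] (q : ℕ) (hq : Fintype.card F = q) (hm : 1 < m)
    (d k : ℕ) (hk : k = (q ^ m - 1) / (q - 1))
    {X : Type*} [Fintype X] [DecidableEq X]
    {R : Fin (d + 1) → X → X → Prop} (hR : IsAssociationScheme R)
    (hyp : Fin d ≃ Hyperplane F m) (pt : Fin d ≃ Point F m) (f r s : ℂ)
    (hP : HasFirstEigenmatrix R (bordered (fun _ => f)
      (r • incidenceMatrix hyp pt + s • (allOnes d - incidenceMatrix hyp pt))))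
    (L : Line F m) (β : Fin (q + 1) ≃ {p : Point F m // LiesOn p L.1}) :
    ∃ g : Fin (d + 1) → Fin (q + 2 + 1), IsFusionMap g ∧
      (∀ j, ¬ LiesOn (pt j) L.1 → g j.succ = 1) ∧
      (∀ j i, pt j = (β i).1 → g j.succ = i.succ.succ) ∧
      IsAssociationScheme (fuse R g) ∧
      HasFirstEigenmatrix (fuse R g) (lineFusionMatrix d k q f r s) := by
  classical
  have hq2 : 2 ≤ q := hq ▸ Fintype.one_lt_card
  have hcard : (Nat.card F : ℂ) = q := by rw [Nat.card_eq_fintype_card, hq]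
  have hL := sum_pointIndicator_line pt L
  have hmul := sum_line_mul pt L
  rw [hcard] at hL
  simp only [hcard] at hmul
  have hsumH : ∀ i, ∑ j, pointIndicator (hyp i).1 (pt j) = (k : ℂ) := by
    intro i
    rw [sum_pointIndicator pt (hyp i).2, natCast_eq_geom_sum hq2 hk, hcard]
  -- Class 0 collects the points off L; the successor of t is the class of the t-th point of L.
  let gp : Point F m → Fin (q + 2) := fun p =>
    if h : LiesOn p L.1 then (β.symm ⟨p, h⟩).succ else 0
  have hgp0 : ∀ p, gp p = 0 ↔ ¬ LiesOn p L.1 := by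
    intro p
    by_cases h : LiesOn p L.1 <;> simp [gp, h, Fin.succ_ne_zero]
  have hgpβ : ∀ p t, gp p = Fin.succ t ↔ p = (β t).1 := by
    intro p t
    by_cases h : LiesOn p L.1
    · simp only [gp, h, dif_pos, Fin.succ_inj, Equiv.symm_apply_eq]
      rw [Subtype.ext_iff]
    · simp only [gp, h, dif_neg, not_false_eq_true]
      exact ⟨fun h' => absurd h'.symm (Fin.succ_ne_zero t), fun h' => absurd (h' ▸ (β t).2) h⟩
  choose c hcL hc using exists_point_inter L
  -- Hyperplanes containing L form class 0; any other takes the class of its intersection point with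
  -- L.
  let hp : Hyperplane F m → Fin (q + 2) := fun H => if h : L.1 ≤ H.1 then 0 else gp (c H h)
  have hp_le : ∀ H, L.1 ≤ H.1 → hp H = 0 := fun H h => by simp [hp, h]
  have hp_not : ∀ H, ¬ L.1 ≤ H.1 → ∃ t, hp H = Fin.succ t ∧
      ∀ p, LiesOn p L.1 → (LiesOn p H.1 ↔ p = (β t).1) := by
    intro H h
    refine ⟨β.symm ⟨c H h, hcL H h⟩, ?_, fun p hp => ?_⟩
    · simp [hp, h, gp, hcL H h]
    · rw [hc H h p hp, Equiv.apply_symm_apply]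
  have hL0 : ∃ p : Point F m, ¬ LiesOn p L.1 := by
    by_contra! hcon
    have : (⊤ : Submodule F (Fin (m + 1) → F)) ≤ L.1 := le_of_forall_liesOn fun p _ => hcon p
    have h2 := L.2
    rw [top_le_iff.1 this, finrank_top, Module.finrank_fin_fun] at h2
    omega
  let g : Fin (d + 1) → Fin (q + 2 + 1) := Fin.cons 0 fun j => (gp (pt j)).succ
  let h : Fin (d + 1) → Fin (q + 2 + 1) := Fin.cons 0 fun i => (hp (hyp i)).succ
  have hg : IsFusionMap g := by
    refine isFusionMap_cons (a := fun j => gp (pt j)) fun t => ?_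
    cases t using Fin.cases with
    | zero =>
      obtain ⟨p, hp⟩ := hL0
      exact ⟨pt.symm p, by simpa using (hgp0 p).2 hp⟩
    | succ t => exact ⟨pt.symm (β t).1, by simpa using (hgpβ _ t).2 rfl⟩
  have hh : IsFusionMap h := by
    refine isFusionMap_cons (a := fun i => hp (hyp i)) fun t => ?_
    cases t using Fin.cases with
    | zero =>
      obtain ⟨H, hH⟩ := exists_hyperplane_of_line_le hm L
      exact ⟨hyp.symm H, by simpa using hp_le H hH⟩
    | succ t =>
      obtain ⟨H, hβ, hH⟩ := exists_hyperplane_inter_line L (β t).2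
      obtain ⟨t', ht', hall⟩ := hp_not H hH
      have : t = t' := β.injective (Subtype.ext ((hall _ (β t).2).1 hβ))
      exact ⟨hyp.symm H, by simpa [this] using ht'⟩
  refine ⟨g, hg, fun j hj => ?_, fun j i hj => ?_, ?_⟩
  · change (gp (pt j)).succ = 1
    rw [(hgp0 _).2 hj]
    rfl
  · change (gp (pt j)).succ = _
    rw [(hgpβ _ i).2 hj]
  refine fuse_of_block_row_sums hR hP hg hh ?_
  intro i u
  rw [sum_filter_eq_add_sum_succ]
  have hgs : ∀ j : Fin d, g j.succ = (gp (pt j)).succ := fun _ => rfl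
  have hg0 : g 0 = 0 := rfl
  have hhs : ∀ j : Fin d, h j.succ = (hp (hyp j)).succ := fun _ => rfl
  simp only [hgs, hg0]
  -- The sum off L is the total minus the sum over L, so only `hsumH` and `sum_line_mul` are needed.
  have off : ∀ a : Fin d → ℂ, (∑ j, if (gp (pt j)).succ = Fin.succ 0 then a j else 0) =
      ∑ j, a j - ∑ j, pointIndicator L.1 (pt j) * a j := by
    intro a
    rw [← Finset.sum_sub_distrib]
    refine Finset.sum_congr rfl fun j _ => ?_
    simp only [Fin.succ_inj, hgp0]
    by_cases hj : LiesOn (pt j) L.1 <;> simp [pointIndicator, hj]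
  have on : ∀ (a : Fin d → ℂ) (t : Fin (q + 1)),
      (∑ j, if (gp (pt j)).succ = t.succ.succ then a j else 0) = a (pt.symm (β t).1) := by
    intro a t
    simp only [Fin.succ_inj, hgpβ, ← Equiv.eq_symm_apply]
    simp
  cases u using Fin.cases with
  | zero =>
    have : ∀ j, ¬ ((gp (pt j)).succ = 0) := fun j => Fin.succ_ne_zero _
    simp only [this, if_true, if_false, Finset.sum_const_zero, add_zero]
    have hone : ∀ t, lineFusionMatrix d k q f r s t 0 = 1 := by
      intro t
      cases t using Fin.cases <;> rfl
    rw [hone]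
    cases i using Fin.cases <;> rfl
  | succ u =>
    rw [if_neg (Fin.succ_ne_zero u).symm, zero_add]
    cases i using Fin.cases with
    | zero =>
      have hrow : ∀ j : Fin d, bordered (fun _ => f)
          (r • incidenceMatrix hyp pt + s • (allOnes d - incidenceMatrix hyp pt)) 0 j.succ = f :=
        fun _ => rfl
      simp only [hrow]
      cases u using Fin.cases with
      | zero =>
        rw [off, ← Finset.sum_mul, hL]
        change _ = ((d : ℂ) - q - 1) * f
        simp
        ring
      | succ t =>
        rw [on]
        rfl
    | succ i =>
      simp only [eigenmatrix_apply, hhs]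
      cases u using Fin.cases with
      | zero =>
        rw [off, hmul, Finset.sum_add_distrib, ← Finset.mul_sum, hsumH]
        by_cases hle : L.1 ≤ (hyp i).1
        · rw [if_pos hle, hp_le _ hle]
          change _ = ((k : ℂ) - q - 1) * r + ((d : ℂ) - k) * s
          simp
          ring
        · obtain ⟨t, ht, -⟩ := hp_not _ hle
          rw [if_neg hle, ht]
          change _ = ((k : ℂ) - 1) * r + ((d : ℂ) - k - q) * s
          simp
          ring
      | succ t =>
        rw [on, Equiv.apply_symm_apply]
        by_cases hle : L.1 ≤ (hyp i).1
        · rw [hp_le _ hle]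
          change _ = r
          have : LiesOn (β t).1 (hyp i).1 := le_trans (β t).2 hle
          simp [pointIndicator, this]
        · obtain ⟨t', ht, hall⟩ := hp_not _ hle
          rw [ht]
          change _ = (r - s) * (1 : Matrix (Fin (q + 1)) (Fin (q + 1)) ℂ) t' t + s * 1
          have : LiesOn (β t).1 (hyp i).1 ↔ t' = t := by
            rw [hall _ (β t).2, ← Subtype.ext_iff, β.injective.eq_iff, eq_comm]
          rw [Matrix.one_apply]
          simp only [pointIndicator, this]
          ring

end Line

/-! ### Part (ii): spreads of PG(3,q). -/

section Spread

variable {F : Type*} [Field F]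

instance finite_line [Finite F] {m : ℕ} : Finite (Line F m) :=
  have : Finite (Submodule F (Fin (m + 1) → F)) :=
    Finite.of_injective (fun W => (W : Set (Fin (m + 1) → F))) SetLike.coe_injective
  inferInstance

theorem exists_liesOn_line {m : ℕ} (L : Line F m) : ∃ p : Point F m, LiesOn p L.1 := by
  have hne : L.1 ≠ ⊥ := fun h => by
    have := L.2
    rw [h, finrank_bot] at this
    omega
  obtain ⟨v, hv, h0⟩ := Submodule.exists_mem_ne_zero_of_ne_bot hne
  exact ⟨Projectivization.mk F v h0, (liesOn_mk h0).2 hv⟩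

/-- The lines of a spread of `PG(3, q)` number `q ^ 2 + 1`. -/
theorem natCard_spread [Finite F] {S : Set (Line F 3)} (hS : IsSpread S) :
    Nat.card S = Nat.card F ^ 2 + 1 := by
  choose ℓ hℓ huniq using hS
  -- The points are the disjoint union of the spread lines, whence |S|(q + 1) = q³ + q² + q + 1 =
  -- (q² + 1)(q + 1).
  let e : Point F 3 ≃ Σ L : S, {p : Point F 3 // LiesOn p L.1.1} :=
    { toFun := fun p => ⟨⟨ℓ p, (hℓ p).1⟩, ⟨p, (hℓ p).2⟩⟩
      invFun := fun x => x.2.1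
      left_inv := fun _ => rfl
      right_inv := by
        rintro ⟨⟨L, hL⟩, ⟨p, hp⟩⟩
        obtain rfl : L = ℓ p := huniq p L ⟨hL, hp⟩
        rfl }
  have hcard := Nat.card_congr e
  have := Fintype.ofFinite S
  rw [Nat.card_sigma, Projectivization.card_of_finrank F _ (Module.finrank_fin_fun F)] at hcard
  simp only [natCard_liesOn_line, Finset.sum_const, Finset.card_univ, smul_eq_mul] at hcard
  rw [← Nat.card_eq_fintype_card] at hcard
  refine Nat.eq_of_mul_eq_mul_right (Nat.succ_pos (Nat.card F)) ?_
  rw [Nat.succ_eq_add_one, ← hcard]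
  simp [Finset.sum_range_succ]
  ring

/-- The regular spread, made of the one-dimensional subspaces over a quadratic extension. -/
theorem exists_isSpread [Finite F] : ∃ S : Set (Line F 3), IsSpread S := by
  obtain ⟨p, hp⟩ := CharP.exists F
  have : Fact p.Prime := ⟨CharP.char_is_prime F p⟩
  let K := FiniteField.Extension F p 2
  have hK : Module.finrank F K = 2 := FiniteField.finrank_extension F p 2
  have : Module.Finite F K := Module.finite_of_finrank_pos (by omega)
  have hfin : Module.finrank F (Fin 2 → K) = Module.finrank F (Fin (3 + 1) → F) := by
    rw [Module.finrank_pi_fintype]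
    simp [hK]
  let φ : (Fin 2 → K) ≃ₗ[F] (Fin (3 + 1) → F) := LinearEquiv.ofFinrankEq _ _ hfin
  -- A K-line of K² is an F-plane; φ carries it to F⁴.
  let W : (Fin 2 → K) → Submodule F (Fin (3 + 1) → F) := fun w =>
    ((K ∙ w).restrictScalars F).map (φ : (Fin 2 → K) →ₗ[F] (Fin (3 + 1) → F))
  have hmem : ∀ v w, v ∈ W w ↔ φ.symm v ∈ K ∙ w := by
    intro v w
    simp only [W, Submodule.mem_map_equiv, Submodule.restrictScalars_mem]
  have hrank : ∀ w, w ≠ 0 → Module.finrank F (W w) = 2 := by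
    intro w hw
    rw [← hK, LinearEquiv.finrank_map_eq φ]
    exact (LinearEquiv.finrank_eq ((LinearEquiv.toSpanNonzeroSingleton K _ w hw).restrictScalars
      F)).symm
  refine ⟨{L | ∃ w, w ≠ 0 ∧ L.1 = W w}, fun x => ?_⟩
  induction x using Projectivization.ind with
  | h v hv =>
    have hv' : φ.symm v ≠ 0 := by simpa using hv
    refine ⟨⟨W (φ.symm v), hrank _ hv'⟩, ⟨⟨_, hv', rfl⟩, ?_⟩, ?_⟩
    · exact (liesOn_mk hv).2 ((hmem _ _).2 (Submodule.mem_span_singleton_self _))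
    · rintro L ⟨⟨w, hw, hL⟩, hx⟩
      have h1 := (liesOn_mk hv).1 hx
      rw [hL, hmem] at h1
      -- A nonzero vector generates every K-line that contains it, which gives uniqueness.
      have h2 : K ∙ φ.symm v = K ∙ w := by
        obtain ⟨c, hc⟩ := Submodule.mem_span_singleton.1 h1
        have hc0 : c ≠ 0 := by
          rintro rfl
          exact hv' (by rw [← hc, zero_smul])
        rw [← hc]
        exact Submodule.span_singleton_smul_eq (IsUnit.mk0 c hc0) w
      apply Subtype.ext
      rw [hL]
      simp only [W, h2]

/-- Fusing the relations that correspond to the points of each line of a spread. -/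
theorem exists_spread_fusion [Fintype F] (q : ℕ) (hq : Fintype.card F = q) (d : ℕ)
    {X : Type*} [Fintype X] [DecidableEq X]
    {R : Fin (d + 1) → X → X → Prop} (hR : IsAssociationScheme R)
    (hyp : Fin d ≃ Hyperplane F 3) (pt : Fin d ≃ Point F 3) (f r s : ℂ)
    (hP : HasFirstEigenmatrix R (bordered (fun _ => f)
      (r • incidenceMatrix hyp pt + s • (allOnes d - incidenceMatrix hyp pt))))
    {S : Set (Line F 3)} (hS : IsSpread S) (e : Fin (q ^ 2 + 1) ≃ S) :
    ∃ g : Fin (d + 1) → Fin (q ^ 2 + 1 + 1), IsFusionMap g ∧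
      (∀ j i, LiesOn (pt j) (e i).1.1 → g j.succ = i.succ) ∧
      IsAssociationScheme (fuse R g) ∧ IsAmorphous (fuse R g) ∧
      HasFirstEigenmatrix (fuse R g) (spreadFusionMatrix q f r s) := by
  classical
  have hq2 : 2 ≤ q := hq ▸ Fintype.one_lt_card
  have hcard : (Nat.card F : ℂ) = q := by rw [Nat.card_eq_fintype_card, hq]
  have hL := fun L => sum_pointIndicator_line pt L
  have hmul := fun L => sum_line_mul pt L
  simp only [hcard] at hL hmul
  have hidx : ∀ p : Point F 3, ∃ t, ∀ u, t = u ↔ LiesOn p (e u).1.1 := by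
    intro p
    obtain ⟨L, ⟨hLS, hpL⟩, huniq⟩ := hS p
    refine ⟨e.symm ⟨L, hLS⟩, fun u => ⟨?_, fun h => ?_⟩⟩
    · rintro rfl
      simpa using hpL
    · rw [Equiv.symm_apply_eq, Subtype.ext_iff, huniq _ ⟨(e u).2, h⟩]
  choose gp hgp using hidx
  -- Double counting of the points of a plane along the spread. The values r = 1 and s = 0 turn
  -- `sum_line_mul` into a plain point count: a spread line contributes q + 1 or 1.
  have hplane : ∀ H : Hyperplane F 3, ∃ t, ∀ u, t = u ↔ (e u).1.1 ≤ H.1 := by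
    intro H
    have h1 : ∑ u, ∑ j, pointIndicator (e u).1.1 (pt j) *
        (0 + (1 - 0) * pointIndicator H.1 (pt j)) = 1 + q + q ^ 2 := by
      rw [Finset.sum_comm]
      have : ∀ j, ∑ u, pointIndicator (e u).1.1 (pt j) = 1 := by
        intro j
        simp [pointIndicator, ← hgp]
      simp only [← Finset.sum_mul, this, zero_add, sub_zero, one_mul]
      rw [sum_pointIndicator pt H.2, hcard]
      simp [Finset.sum_range_succ]
    have h2 : ∀ u, (if (e u).1.1 ≤ H.1 then (q : ℂ) + 1 else 1) =
        1 + q * if (e u).1.1 ≤ H.1 then 1 else 0 := by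
      intro u
      split_ifs <;> ring
    rw [Finset.sum_congr rfl fun u _ => hmul (e u).1 H 1 0] at h1
    simp only [h2, zero_mul, zero_add, sub_zero, one_mul] at h1
    rw [Finset.sum_add_distrib, ← Finset.mul_sum, Finset.sum_boole] at h1
    have h3 : (q : ℂ) * ((Finset.univ.filter fun u => (e u).1.1 ≤ H.1).card : ℂ) = q * 1 := by
      simp only [Finset.sum_const, Finset.card_univ, Fintype.card_fin, nsmul_eq_mul] at h1
      push_cast at h1
      linear_combination h1
    have hq0 : (q : ℂ) ≠ 0 := by
      norm_cast
      omega
    have h4 := mul_left_cancel₀ hq0 h3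
    obtain ⟨t, ht⟩ := Finset.card_eq_one.1 (by exact_mod_cast h4)
    refine ⟨t, fun u => ?_⟩
    have := Finset.ext_iff.1 ht u
    simp only [Finset.mem_filter, Finset.mem_univ, true_and, Finset.mem_singleton] at this
    rw [this, eq_comm]
  choose hp hhp using hplane
  let g : Fin (d + 1) → Fin (q ^ 2 + 1 + 1) := Fin.cons 0 fun j => (gp (pt j)).succ
  let h : Fin (d + 1) → Fin (q ^ 2 + 1 + 1) := Fin.cons 0 fun i => (hp (hyp i)).succ
  have hg : IsFusionMap g := by
    refine isFusionMap_cons (a := fun j => gp (pt j)) fun t => ?_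
    obtain ⟨p, hpt⟩ := exists_liesOn_line (e t).1
    exact ⟨pt.symm p, by simpa using (hgp p t).2 hpt⟩
  have hh : IsFusionMap h := by
    refine isFusionMap_cons (a := fun i => hp (hyp i)) fun t => ?_
    obtain ⟨H, hH⟩ := exists_hyperplane_of_line_le (by norm_num) (e t).1
    exact ⟨hyp.symm H, by simpa using (hhp H t).2 hH⟩
  have key : IsAssociationScheme (fuse R g) ∧
      HasFirstEigenmatrix (fuse R g) (spreadFusionMatrix q f r s) := by
    refine fuse_of_block_row_sums hR hP hg hh ?_
    intro i u
    rw [sum_filter_eq_add_sum_succ]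
    have hgs : ∀ j : Fin d, g j.succ = (gp (pt j)).succ := fun _ => rfl
    have hg0 : g 0 = 0 := rfl
    have hhs : ∀ j : Fin d, h j.succ = (hp (hyp j)).succ := fun _ => rfl
    simp only [hgs, hg0]
    cases u using Fin.cases with
    | zero =>
      have : ∀ j, ¬ ((gp (pt j)).succ = 0) := fun j => Fin.succ_ne_zero _
      simp only [this, if_true, if_false, Finset.sum_const_zero, add_zero]
      have hone : ∀ t, spreadFusionMatrix q f r s t 0 = 1 := by
        intro t
        cases t using Fin.cases <;> rfl
      rw [hone]
      cases i using Fin.cases <;> rfl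
    | succ u =>
      rw [if_neg (Fin.succ_ne_zero u).symm, zero_add]
      -- The class of u consists exactly of the points on its spread line.
      have hrow : ∀ a : Fin d → ℂ, (∑ j, if (gp (pt j)).succ = u.succ then a j else 0) =
          ∑ j, pointIndicator (e u).1.1 (pt j) * a j := by
        intro a
        refine Finset.sum_congr rfl fun j _ => ?_
        simp only [Fin.succ_inj, hgp, pointIndicator, ite_mul, one_mul, zero_mul]
      rw [hrow]
      cases i using Fin.cases with
      | zero =>
        change ∑ j, pointIndicator (e u).1.1 (pt j) * f = ((q : ℂ) + 1) * f
        rw [← Finset.sum_mul, hL]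
      | succ i =>
        simp only [eigenmatrix_apply, hhs, hmul]
        change _ = (q : ℂ) * (r - s) *
          (1 : Matrix (Fin (q ^ 2 + 1)) (Fin (q ^ 2 + 1)) ℂ) (hp (hyp i)) u + (r + s * q) * 1
        rw [Matrix.one_apply]
        simp only [hhp]
        -- The two cases are (q + 1)r = q(r - s) + (r + sq) and s(q + 1) + (r - s) = r + sq.
        split_ifs <;> ring
  refine ⟨g, hg, fun j i hj => ?_, key.1, isAmorphous_of_hasFirstEigenmatrix key.1 key.2, key.2⟩
  change (gp (pt j)).succ = i.succ
  rw [(hgp _ _).2 hj]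

end Spread

end AssocScheme

end

theorem theorem3
    {F : Type*} [Field F] [Fintype F] (q : ℕ) (hq : Fintype.card F = q)
    (m : ℕ) (hm : 1 < m)
    (d k : ℕ) (hd : d = (q ^ (m + 1) - 1) / (q - 1)) (hk : k = (q ^ m - 1) / (q - 1))
    {X : Type*} [Fintype X] [DecidableEq X]
    (R : Fin (d + 1) → X → X → Prop) (hR : AssocScheme.IsAssociationScheme R)
    (hyp : Fin d ≃ AssocScheme.Hyperplane F m) (pt : Fin d ≃ AssocScheme.Point F m)
    (f r s : ℂ)
    (hP : AssocScheme.HasFirstEigenmatrix R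
      (AssocScheme.bordered (fun _ => f)
        (r • AssocScheme.incidenceMatrix hyp pt +
          s • (AssocScheme.allOnes d - AssocScheme.incidenceMatrix hyp pt)))) :
    -- (i), existence
    (∃ R' : Fin (q + 2 + 1) → X → X → Prop, AssocScheme.IsFusionScheme R R' ∧
      AssocScheme.HasFirstEigenmatrix R' (AssocScheme.lineFusionMatrix d k q f r s)) ∧
    -- (i), each line, with any labelling of its points, yields such a fusion scheme
    (∀ (L : AssocScheme.Line F m)
      (β : Fin (q + 1) ≃ {p : AssocScheme.Point F m // AssocScheme.LiesOn p L.1}),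
      ∃ g : Fin (d + 1) → Fin (q + 2 + 1), AssocScheme.IsFusionMap g ∧
        (∀ j, ¬ AssocScheme.LiesOn (pt j) L.1 → g j.succ = 1) ∧
        (∀ j i, pt j = (β i).1 → g j.succ = i.succ.succ) ∧
        AssocScheme.IsAssociationScheme (AssocScheme.fuse R g) ∧
        AssocScheme.HasFirstEigenmatrix (AssocScheme.fuse R g)
          (AssocScheme.lineFusionMatrix d k q f r s)) ∧
    (m = 3 →
      -- (ii), existence
      (∃ R' : Fin (q ^ 2 + 1 + 1) → X → X → Prop, AssocScheme.IsFusionScheme R R' ∧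
        AssocScheme.IsAmorphous R' ∧
        AssocScheme.HasFirstEigenmatrix R' (AssocScheme.spreadFusionMatrix q f r s)) ∧
      -- (ii), each spread, with any labelling of its lines, yields such a fusion scheme
      (∀ (S : Set (AssocScheme.Line F m)), AssocScheme.IsSpread S →
        ∀ e : Fin (q ^ 2 + 1) ≃ S,
        ∃ g : Fin (d + 1) → Fin (q ^ 2 + 1 + 1), AssocScheme.IsFusionMap g ∧
          (∀ j i, AssocScheme.LiesOn (pt j) (e i).1.1 → g j.succ = i.succ) ∧
          AssocScheme.IsAssociationScheme (AssocScheme.fuse R g) ∧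
          AssocScheme.IsAmorphous (AssocScheme.fuse R g) ∧
          AssocScheme.HasFirstEigenmatrix (AssocScheme.fuse R g)
            (AssocScheme.spreadFusionMatrix q f r s))) := by

  have line := AssocScheme.exists_line_fusion q hq hm d k hk hR hyp pt f r s hP
  refine ⟨?_, line, ?_⟩
  · obtain ⟨L⟩ := AssocScheme.exists_line (F := F) hm
    have hcard := AssocScheme.natCard_liesOn_line L
    rw [Nat.card_eq_fintype_card (α := F), hq] at hcard
    obtain ⟨g, hg, -, -, h1, h2⟩ := line L (Finite.equivFinOfCardEq hcard).symm
    exact ⟨_, ⟨h1, g, hg, rfl⟩, h2⟩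
  · rintro rfl
    have spread := fun S (hS : AssocScheme.IsSpread S) =>
      AssocScheme.exists_spread_fusion q hq d hR hyp pt f r s hP hS
    refine ⟨?_, spread⟩
    obtain ⟨S, hS⟩ := AssocScheme.exists_isSpread (F := F)
    have hcard := AssocScheme.natCard_spread hS
    rw [Nat.card_eq_fintype_card (α := F), hq] at hcard
    obtain ⟨g, hg, -, h1, h2, h3⟩ := spread S hS (Finite.equivFinOfCardEq hcard).symm
    exact ⟨_, ⟨h1, g, hg, rfl⟩, h2, h3⟩
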